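/- Let $d\ge 0$ be an integer, let $D$ be a probability distribution on $\mathbb R^d\times\{\pm1\}$, and let $D_X$ be its marginal on $\mathbb R^d$. For $h:\mathbb R^d\to\mathbb R$ and $\gamma\ge 0$ put $\ell_\gamma(h,D)=\mathbb P_{(X,Y)\sim D}[Y\,h(X)\le\gamma]$, and for a labeled sample $S=((x_i,y_i))_{i=1}^n$, $n\ge1$, put $\ell_\gamma(h,S)=\frac1n|\{i: y_ih(x_i)\le\gamma\}|$. Let $\mathcal W=\{x\mapsto\langle x,w\rangle : w\in\mathbb R^d,\ \|w\|\le1\}$ and $\ell^*_\gamma(D)=\inf_{h\in\mathcal W}\ell_\gamma(h,D)$. A margin-error minimization (MEM) algorithm $\mathcal A$ assigns to every $\gamma>0$ a map $\mathcal A_\gamma$ which takes every labeled sample $S$ of every size $n\ge 1$ to some $\mathcal A_\gamma(S)\in\operatorname{argmin}_{h\in\mathcal W}\ell_\gamma(h,S)$. Put $$\ell_0(\mathcal A_\gamma,D,n,\delta)=\inf\{\epsilon'\ge0 : \mathbb P_{S\sim D^n}[\ell_0(\mathcal A_\gamma(S),D)\ge\epsilon']\le\delta\}.$$ The sample complexity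 $m(\epsilon,\gamma,D,\delta)\in\{1,2,\dots\}\cup\{\infty\}$ is the least $m\ge1$ such that $\ell_0(\mathcal A_\gamma,D,n,\delta)-\ell^*_\gamma(D)\le\epsilon$ for every MEM algorithm $\mathcal A$ and every $n\ge m$ (and $\infty$ if there is no such $m$). The margin-adapted dimension $k_\gamma(D_X)$ is the least integer $k\ge1$ for which there is a linear subspace $V\subseteq\mathbb R^d$ of dimension $d-k$ with $\mathbb E_{X\sim D_X}[\|O_VX\|^2]\le\gamma^2k$, where $O_V$ is the orthogonal projection onto $V$ (for $d=0$, put $k_\gamma(D_X)=0$). A real random variable $Z$ is sub-Gaussian with moment $B\ge0$ if $\mathbb E[e^{tZ}]\le e^{t^2B^2/2}$ for all $t\in\mathbb R$, and it has relative moment $\rho>0$ if it is sub-Gaussian with moment $\rho\sqrt{\mathbb E[Z^2]}$. Let $\mathcal D_\rho$ be the family of all distributions on some $\mathbb R^d$ ($d$ arbitrary) for which there are an orthonormal basis $a_1,\dots,a_d$ of $\mathbb R^d$ and a $B\ge0$ such that, for $X$ with that distribution, $\langle a_1,X\rangle,\dots,\langle a_d,X\rangle$ are independent and each is sub-Gaussian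 with moment $B$ and with relative moment $\rho$. **Theorem.** For every $\rho>0$ there are constants $\beta>0$ and $C\ge0$, depending only on $\rho$, such that for every dimension $d$, every distribution $D$ on $\mathbb R^d\times\{\pm1\}$ with $D_X\in\mathcal D_\rho$, every $\gamma>0$ and every real $\epsilon<\frac12-\ell^*_\gamma(D)$, $$m(\epsilon,\gamma,D,1/4)\ \ge\ \beta\,k_\gamma(D_X)-C.$$ -/

import Mathlib

open MeasureTheory ProbabilityTheory

noncomputable section

namespace MarginLearning

/-- The label set `{±1}`. -/
abbrev Label : Type := {y : ℝ // y = 1 ∨ y = -1}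

/-- The margin error `ℓ_γ(h, D) = P_{(X,Y) ∼ D}[Y · h(X) ≤ γ]`. For `γ = 0` this is the
misclassification error `ℓ_0(h, D)`. -/
def marginLoss {𝒳 : Type*} [MeasurableSpace 𝒳] (γ : ℝ) (h : 𝒳 → ℝ)
    (D : Measure (𝒳 × Label)) : ℝ :=
  D.real {p | (p.2 : ℝ) * h p.1 ≤ γ}

/-- The best achievable margin error `ℓ*_γ(H, D) = inf_{h ∈ H} ℓ_γ(h, D)`. -/
def bestMarginLoss {𝒳 : Type*} [MeasurableSpace 𝒳] (H : Set (𝒳 → ℝ)) (γ : ℝ)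
    (D : Measure (𝒳 × Label)) : ℝ :=
  ⨅ h : H, marginLoss γ (h : 𝒳 → ℝ) D

/-- The empirical margin error of `h` on the labeled sample `S = ((x_i, y_i))_{i < n}`. -/
def empMarginLoss {𝒳 : Type*} (γ : ℝ) (h : 𝒳 → ℝ) {n : ℕ} (S : Fin n → 𝒳 × Label) : ℝ :=
  ((Finset.univ.filter fun i => ((S i).2 : ℝ) * h (S i).1 ≤ γ).card : ℝ) / n

/-- A learning algorithm maps a labeled sample of any size to a real-valued classifier.
(Its value on the empty sample is never used below.) -/
abbrev LearningAlgorithm (𝒳 : Type*) : Type _ :=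
  (n : ℕ) → (Fin n → 𝒳 × Label) → (𝒳 → ℝ)

/-- `A` is a margin-error minimization algorithm for the hypothesis class `H`: for every margin
`γ > 0` and every (nonempty) sample `S`, `A γ` returns a minimizer over `H` of the empirical
`γ`-margin error on `S`. -/
def IsMEM {𝒳 : Type*} (H : Set (𝒳 → ℝ)) (A : ℝ → LearningAlgorithm 𝒳) : Prop :=
  ∀ γ : ℝ, 0 < γ → ∀ n : ℕ, 1 ≤ n → ∀ S : Fin n → 𝒳 × Label,
    A γ n S ∈ H ∧ ∀ g ∈ H, empMarginLoss γ (A γ n S) S ≤ empMarginLoss γ g S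

/-- The high-probability misclassification loss
`ℓ_0(A, D, n, δ) = inf {ε ≥ 0 | P_{S ∼ D^n}[ℓ_0(A(S), D) ≥ ε] ≤ δ}`. -/
def highProbLoss {𝒳 : Type*} [MeasurableSpace 𝒳] (A : LearningAlgorithm 𝒳)
    (D : Measure (𝒳 × Label)) (n : ℕ) (δ : ℝ) : ℝ :=
  sInf {ε : ℝ | 0 ≤ ε ∧
    (Measure.pi fun _ : Fin n => D).real {S | ε ≤ marginLoss 0 (A n S) D} ≤ δ}

/-- The distribution-specific sample complexity `m(ε, γ, D, δ)` for the hypothesis class `H`: the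
least sample size `m ≥ 1` such that every MEM algorithm has excess error at most `ε` on samples of
any size `n ≥ m`. It is `⊤` if there is no such sample size. -/
def sampleComplexity {𝒳 : Type*} [MeasurableSpace 𝒳] (H : Set (𝒳 → ℝ)) (ε γ : ℝ)
    (D : Measure (𝒳 × Label)) (δ : ℝ) : ℕ∞ :=
  ⨅ m ∈ {m : ℕ | 1 ≤ m ∧ ∀ A : ℝ → LearningAlgorithm 𝒳, IsMEM H A → ∀ n : ℕ, m ≤ n →
    highProbLoss (A γ) D n δ - bestMarginLoss H γ D ≤ ε}, (m : ℕ∞)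

/-- The class of homogeneous linear separators `x ↦ ⟨x, w⟩` with `‖w‖ ≤ 1`. -/
def linearClass (d : ℕ) : Set (EuclideanSpace ℝ (Fin d) → ℝ) :=
  {h | ∃ w : EuclideanSpace ℝ (Fin d), ‖w‖ ≤ 1 ∧ h = fun x => inner ℝ x w}

/-- `P` is `(b, k)`-limited: for some subspace `V` of dimension `d - k`, the expected squared norm
of the orthogonal projection onto `V` is at most `b`. (The expectation may be infinite.) -/
def IsLimited {d : ℕ} (P : Measure (EuclideanSpace ℝ (Fin d))) (b : ℝ) (k : ℕ) : Prop :=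
  ∃ V : Submodule ℝ (EuclideanSpace ℝ (Fin d)), Module.finrank ℝ V + k = d ∧
    ∫⁻ x, ENNReal.ofReal (‖V.starProjection x‖ ^ 2) ∂P ≤ ENNReal.ofReal b

/-- The margin-adapted dimension `k_γ(P)`: the least positive integer `k` such that `P` is
`(γ²k, k)`-limited. For `d ≥ 1` such a `k` exists, since `k = d` is one; for `d = 0` there is none
and the value is `0`. -/
def marginAdaptedDim {d : ℕ} (γ : ℝ) (P : Measure (EuclideanSpace ℝ (Fin d))) : ℕ :=
  sInf {k : ℕ | 1 ≤ k ∧ IsLimited P (γ ^ 2 * k) k}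

/-- `X` is sub-Gaussian with moment `B`: `E[exp(tX)] ≤ exp(t²B²/2)` for all real `t`. -/
def IsSubGaussian {Ω : Type*} [MeasurableSpace Ω] (X : Ω → ℝ) (B : ℝ) (μ : Measure Ω) : Prop :=
  HasSubgaussianMGF X (Real.toNNReal (B ^ 2)) μ

/-- `X` is sub-Gaussian with relative moment `ρ`: it is sub-Gaussian with moment `ρ √E[X²]`. -/
def IsRelSubGaussian {Ω : Type*} [MeasurableSpace Ω] (X : Ω → ℝ) (ρ : ℝ) (μ : Measure Ω) : Prop :=
  IsSubGaussian X (ρ * Real.sqrt (∫ ω, X ω ^ 2 ∂μ)) μ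

/-- `P` is a sub-Gaussian product distribution with moment `B` and relative moment `ρ`. -/
def IsSubGaussianProduct {d : ℕ} (P : Measure (EuclideanSpace ℝ (Fin d))) (B ρ : ℝ) : Prop :=
  ∃ a : OrthonormalBasis (Fin d) ℝ (EuclideanSpace ℝ (Fin d)),
    iIndepFun (fun i x => inner ℝ (a i) x) P ∧
    ∀ i, IsSubGaussian (fun x => inner ℝ (a i) x) B P ∧
      IsRelSubGaussian (fun x => inner ℝ (a i) x) ρ P

/-- `P` belongs to the family `𝒟_ρ` of sub-Gaussian product distributions with relative
moment `ρ` (and some moment `B ≥ 0`). -/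
def InFamily {d : ℕ} (ρ : ℝ) (P : Measure (EuclideanSpace ℝ (Fin d))) : Prop :=
  ∃ B : ℝ, 0 ≤ B ∧ IsSubGaussianProduct P B ρ

end MarginLearning

end

/-!
The idea is to draw a double sample and to show that, as long as its size is a small multiple of the
margin-adapted dimension `k`, it is shattered with margin `γ` by the unit ball. When this happens, a
separator which is right on one half of the double sample and wrong on the other half is an
empirical minimizer for the former; the same applies with the two halves, or the signs, exchanged,
so that one of the two halves admits an empirical minimizer of true error at least `1 / 2`.

A finite set of points is shattered with margin `γ` as soon as its Gram matrix is bounded below by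
`γ² m`, with `m` the number of points. In the basis of independent coordinates, minimality of `k`
means that the variances truncated at `γ²` sum up to at least `γ² (k - 1)`. Shrinking the
coordinates to truncate their variances is a contraction, so it may only lower the Gram matrix; the
quadratic form of the shrunk sample at a fixed unit vector is a sum of independent squares of
sub-Gaussian variables, which concentrates, and a net of the sphere makes this bound uniform.
-/

open scoped NNReal RealInnerProductSpace

namespace MarginLearning

section Nets

variable {E : Type*} [NormedAddCommGroup E] [NormedSpace ℝ E] [FiniteDimensional ℝ E]

lemma card_le_of_isSeparated_of_subset_closedBall {ε : ℝ≥0} (hε : 0 < ε) {r : ℝ} (hr : 0 ≤ r)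
    {x : E} {N : Finset E} (hN : (N : Set E) ⊆ Metric.closedBall x r)
    (hsep : Metric.IsSeparated ε (N : Set E)) :
    (N.card : ℝ) ≤ (1 + 2 * r / ε) ^ Module.finrank ℝ E := by
  borelize E
  let μ : Measure E := Measure.addHaar
  have hε' : (0 : ℝ) < ε / 2 := by positivity
  have hR : 0 < r + ε / 2 := by positivity
  have hdisj : (N : Set E).PairwiseDisjoint fun c => Metric.ball c (ε / 2 : ℝ) := by
    intro c hc d hd hcd
    refine Metric.ball_disjoint_ball ?_
    have hlt : (ε : ENNReal) < edist c d := hsep hc hd hcd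
    rw [add_halves, dist_edist]
    exact ENNReal.toReal_mono (edist_ne_top c d) hlt.le
  have hsub : ⋃ c ∈ N, Metric.ball c (ε / 2 : ℝ) ⊆ Metric.ball x (r + ε / 2) :=
    Set.iUnion₂_subset fun c hc => Metric.ball_subset_ball' <| by
      linarith [Metric.mem_closedBall.1 (hN hc)]
  have hvol : N.card * ENNReal.ofReal ((ε / 2 : ℝ) ^ Module.finrank ℝ E) * μ (Metric.ball 0 1) ≤
      ENNReal.ofReal ((r + ε / 2) ^ Module.finrank ℝ E) * μ (Metric.ball 0 1) :=
    calc
      _ = μ (⋃ c ∈ N, Metric.ball c (ε / 2 : ℝ)) := by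
        rw [measure_biUnion_finset hdisj fun c _ => measurableSet_ball]
        simp only [μ.addHaar_ball_of_pos _ hε', Finset.sum_const, nsmul_eq_mul, mul_assoc]
      _ ≤ μ (Metric.ball x (r + ε / 2)) := measure_mono hsub
      _ = _ := μ.addHaar_ball_of_pos _ hR
  have hcard : (N.card : ℝ) * (ε / 2) ^ Module.finrank ℝ E ≤
      (r + ε / 2) ^ Module.finrank ℝ E := by
    have hle := (ENNReal.mul_le_mul_iff_left
      (Metric.measure_ball_pos μ (0 : E) zero_lt_one).ne' measure_ball_lt_top.ne).1 hvol
    rw [← ENNReal.ofReal_natCast, ← ENNReal.ofReal_mul (Nat.cast_nonneg _)] at hle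
    exact (ENNReal.ofReal_le_ofReal_iff (by positivity)).1 hle
  have hratio : 1 + 2 * r / ε = (r + ε / 2) / (ε / 2) := by
    field_simp
    ring
  rwa [hratio, div_pow, le_div_iff₀ (by positivity)]

lemma exists_finset_isCover_of_subset_closedBall {ε : ℝ≥0} (hε : 0 < ε) {r : ℝ} (hr : 0 ≤ r)
    {x : E} {A : Set E} (hA : A ⊆ Metric.closedBall x r) :
    ∃ N : Finset E, (N : Set E) ⊆ A ∧ Metric.IsCover ε A (N : Set E) ∧
      (N.card : ℝ) ≤ (1 + 2 * r / ε) ^ Module.finrank ℝ E := by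
  have htot : TotallyBounded A := (isCompact_closedBall x r).totallyBounded.subset hA
  have hpack : Metric.packingNumber ε A ≠ ⊤ := by
    obtain ⟨C, -, hC, hcover⟩ :=
      Metric.exists_finite_isCover_of_totallyBounded (half_pos hε).ne' htot
    have hle : Metric.packingNumber ε A ≤ C.encard := by
      have h := (Metric.packingNumber_two_mul_le_externalCoveringNumber (ε / 2) A).trans
        hcover.externalCoveringNumber_le_encard
      rwa [mul_div_cancel₀ ε two_ne_zero] at h
    exact (hle.trans_lt hC.encard_lt_top).ne
  have hfin : (Metric.maximalSeparatedSet ε A).Finite := by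
    rw [← Set.encard_ne_top_iff, Metric.encard_maximalSeparatedSet hpack]
    exact hpack
  have hsub : (hfin.toFinset : Set E) ⊆ A := by
    simpa only [hfin.coe_toFinset] using Metric.maximalSeparatedSet_subset
  refine ⟨hfin.toFinset, hsub, ?_,
    card_le_of_isSeparated_of_subset_closedBall hε hr (hsub.trans hA) ?_⟩
  · simpa only [hfin.coe_toFinset] using Metric.isCover_maximalSeparatedSet hpack
  · simpa only [hfin.coe_toFinset] using Metric.isSeparated_maximalSeparatedSet

end Nets

section NetBounds

variable {E F : Type*} [NormedAddCommGroup E] [NormedSpace ℝ E] [NormedAddCommGroup F]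
  [NormedSpace ℝ F] (L : E →L[ℝ] F) {ε : ℝ≥0} {N : Set E}

lemma exists_norm_apply_le_add_of_isCover_sphere (hN : Metric.IsCover ε (Metric.sphere 0 1) N)
    {u : E} (hu : ‖u‖ = 1) :
    ∃ v ∈ N, ‖L u‖ ≤ ‖L v‖ + ‖L‖ * ε ∧ ‖L v‖ ≤ ‖L u‖ + ‖L‖ * ε := by
  obtain ⟨v, hv, huv⟩ := hN (mem_sphere_zero_iff_norm.2 hu)
  have hdist : ‖L u - L v‖ ≤ ‖L‖ * ε := by
    rw [← map_sub]
    refine (L.le_opNorm _).trans ?_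
    gcongr
    rw [← dist_eq_norm]
    exact dist_le_coe.2 (edist_le_coe.1 huv)
  exact ⟨v, hv, by linarith [norm_sub_norm_le (L u) (L v)],
    by linarith [norm_sub_norm_le (L v) (L u), norm_sub_rev (L u) (L v)]⟩

lemma opNorm_le_two_mul_of_isCover_sphere (hN : Metric.IsCover ε (Metric.sphere 0 1) N)
    (hε : ε ≤ 1 / 2) {b : ℝ} (hb : 0 ≤ b) (hL : ∀ v ∈ N, ‖L v‖ ≤ b) : ‖L‖ ≤ 2 * b := by
  have : (ε : ℝ) ≤ 1 / 2 := by exact_mod_cast hε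
  have hself : ‖L‖ ≤ b + ‖L‖ * ε := by
    refine L.opNorm_le_of_unit_norm (by positivity) fun u hu => ?_
    obtain ⟨v, hv, huv, -⟩ := exists_norm_apply_le_add_of_isCover_sphere L hN hu
    linarith [hL v hv]
  nlinarith [norm_nonneg L]

lemma sub_le_norm_apply_of_isCover_sphere (hN : Metric.IsCover ε (Metric.sphere 0 1) N)
    (hε : ε ≤ 1 / 2) {a b : ℝ} (hb : 0 ≤ b) (hlower : ∀ v ∈ N, a ≤ ‖L v‖)
    (hupper : ∀ v ∈ N, ‖L v‖ ≤ b) {u : E} (hu : ‖u‖ = 1) : a - 2 * b * ε ≤ ‖L u‖ := by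
  obtain ⟨v, hv, -, hvu⟩ := exists_norm_apply_le_add_of_isCover_sphere L hN hu
  have hL : ‖L‖ * ε ≤ 2 * b * ε := by
    gcongr
    exact opNorm_le_two_mul_of_isCover_sphere L hN hε hb hupper
  linarith [hlower v hv]

end NetBounds

section Interpolation

lemma mul_norm_le_norm_apply {𝕜 E F : Type*} [RCLike 𝕜] [NormedAddCommGroup E] [NormedSpace 𝕜 E]
    [NormedAddCommGroup F] [NormedSpace 𝕜 F] {T : F →L[𝕜] E} {m : ℝ}
    (hT : ∀ u, ‖u‖ = 1 → m ≤ ‖T u‖) (u : F) : m * ‖u‖ ≤ ‖T u‖ := by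
  rcases eq_or_ne u 0 with rfl | hu
  · simp
  have hunit := hT ((‖u‖⁻¹ : 𝕜) • u) (norm_smul_inv_norm hu)
  rwa [map_smul, norm_smul, norm_inv, RCLike.norm_coe_norm, ← div_eq_inv_mul,
    le_div_iff₀ (norm_pos_iff.2 hu)] at hunit

open ContinuousLinearMap in
lemma exists_adjoint_apply_eq {𝕜 E F : Type*} [RCLike 𝕜] [NormedAddCommGroup E]
    [InnerProductSpace 𝕜 E] [CompleteSpace E] [NormedAddCommGroup F] [InnerProductSpace 𝕜 F]
    [FiniteDimensional 𝕜 F] [CompleteSpace F] {T : F →L[𝕜] E} {m : ℝ} (hm : 0 < m)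
    (hT : ∀ u, m * ‖u‖ ≤ ‖T u‖) (y : F) : ∃ w, adjoint T w = y ∧ m * ‖w‖ ≤ ‖y‖ := by
  have hinj : Function.Injective (adjoint T ∘L T) := by
    rw [injective_iff_map_eq_zero]
    intro u hu
    have hTu : ‖T u‖ ^ 2 = 0 := by
      rw [apply_norm_sq_eq_inner_adjoint_left, hu, inner_zero_left, map_zero]
    have hle : m * ‖u‖ ≤ 0 := (hT u).trans_eq (pow_eq_zero_iff two_ne_zero |>.1 hTu)
    exact norm_le_zero_iff.1 (nonpos_of_mul_nonpos_right hle hm)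
  obtain ⟨u, hu : adjoint T (T u) = y⟩ :=
    (adjoint T ∘L T).toLinearMap.injective_iff_surjective.1 hinj y
  refine ⟨T u, hu, ?_⟩
  have hsq : ‖T u‖ ^ 2 ≤ ‖y‖ * ‖u‖ := by
    rw [apply_norm_sq_eq_inner_adjoint_left, ← hu]
    exact (RCLike.re_le_norm _).trans (norm_inner_le_norm _ _)
  rcases (norm_nonneg (T u)).eq_or_lt with h0 | hpos
  · rw [← h0, mul_zero]
    exact norm_nonneg y
  · refine le_of_mul_le_mul_right ?_ hpos
    calc m * ‖T u‖ * ‖T u‖ = m * ‖T u‖ ^ 2 := by ring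
      _ ≤ m * (‖y‖ * ‖u‖) := by gcongr
      _ = ‖y‖ * (m * ‖u‖) := by ring
      _ ≤ ‖y‖ * ‖T u‖ := by gcongr; exact hT u

end Interpolation

section Shattering

/-- The points `x j` are shattered by `H` with margin `γ`: every pattern of signs on them is
realized by some `h ∈ H` with margin larger than `γ`. -/
def ShatteredWithMargin {𝒳 ι : Type*} (H : Set (𝒳 → ℝ)) (γ : ℝ) (x : ι → 𝒳) : Prop :=
  ∀ y : ι → ℝ, (∀ j, |y j| = 1) → ∃ h ∈ H, ∀ j, γ < y j * h (x j)

variable {ι E F : Type*} [Fintype ι] [NormedAddCommGroup E] [InnerProductSpace ℝ E]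
  [NormedAddCommGroup F] [InnerProductSpace ℝ F]

/-- The synthesis operator `u ↦ ∑ j, u j • x j` of a finite family of vectors. Its adjoint is the
analysis operator `w ↦ (⟪x j, w⟫)_j`, which evaluates linear functionals on the family. -/
noncomputable def synthesis (x : ι → E) : EuclideanSpace ℝ ι →L[ℝ] E :=
  ∑ j, (EuclideanSpace.proj j : EuclideanSpace ℝ ι →L[ℝ] ℝ).smulRight (x j)

lemma synthesis_apply (x : ι → E) (u : EuclideanSpace ℝ ι) :
    synthesis x u = ∑ j, u j • x j := by
  simp [synthesis]

lemma map_synthesis (L : E →L[ℝ] F) (x : ι → E) (u : EuclideanSpace ℝ ι) :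
    L (synthesis x u) = synthesis (fun j => L (x j)) u := by
  simp only [synthesis_apply, map_sum, map_smul]

lemma adjoint_synthesis_apply [CompleteSpace E] (x : ι → E) (w : E) (j : ι) :
    ContinuousLinearMap.adjoint (synthesis x) w j = ⟪x j, w⟫ := by
  classical
  have h := ContinuousLinearMap.adjoint_inner_right (synthesis x) (EuclideanSpace.single j 1) w
  simpa [synthesis_apply, EuclideanSpace.inner_single_left] using h

lemma exists_norm_le_one_forall_lt_mul_inner [CompleteSpace E] {x : ι → E} {γ m : ℝ} (hm : 0 < m)
    (hγ : γ * √(Fintype.card ι) < m) (hx : ∀ u, ‖u‖ = 1 → m ≤ ‖synthesis x u‖) {y : ι → ℝ}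
    (hy : ∀ j, |y j| = 1) : ∃ w : E, ‖w‖ ≤ 1 ∧ ∀ j, γ < y j * ⟪x j, w⟫ := by
  obtain ⟨w, hw, hnorm⟩ :=
    exists_adjoint_apply_eq hm (mul_norm_le_norm_apply hx) (WithLp.toLp 2 y)
  have hy_norm : ‖WithLp.toLp 2 y‖ = √(Fintype.card ι) := by
    simp [EuclideanSpace.norm_eq, hy]
  rw [hy_norm] at hnorm
  refine ⟨(m / √(Fintype.card ι)) • w, ?_, fun j => ?_⟩
  · rw [norm_smul, Real.norm_of_nonneg (by positivity), div_mul_eq_mul_div]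
    exact div_le_one_of_le₀ hnorm (Real.sqrt_nonneg _)
  · have hn : 0 < √(Fintype.card ι : ℝ) := by
      have : Nonempty ι := ⟨j⟩
      positivity
    have hinner : ⟪x j, w⟫ = y j := by rw [← adjoint_synthesis_apply, hw]
    have hyy : y j * y j = 1 := by rw [← abs_mul_abs_self, hy, one_mul]
    rw [inner_smul_right, hinner, mul_left_comm, hyy, mul_one, lt_div_iff₀ hn]
    exact hγ

lemma shatteredWithMargin_linearClass {d : ℕ} {x : ι → EuclideanSpace ℝ (Fin d)} {γ m : ℝ}
    (hm : 0 < m) (hγ : γ * √(Fintype.card ι) < m) (hx : ∀ u, ‖u‖ = 1 → m ≤ ‖synthesis x u‖) :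
    ShatteredWithMargin (linearClass d) γ x := fun _ hy => by
  obtain ⟨w, hw, hmargin⟩ := exists_norm_le_one_forall_lt_mul_inner hm hγ hx hy
  exact ⟨_, ⟨w, hw, rfl⟩, hmargin⟩

end Shattering

section SubGaussianSquares

lemma lintegral_exp_mul_sq_gaussianReal {x : ℝ} (hx : x < 1) :
    ∫⁻ g, ENNReal.ofReal (Real.exp (x / 2 * g ^ 2)) ∂(gaussianReal 0 1) =
      ENNReal.ofReal (√(1 - x))⁻¹ := by
  have hx' : 0 < 1 - x := sub_pos.2 hx
  have hdensity : ∀ g : ℝ,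
      (gaussianPDF 0 1 * fun g => ENNReal.ofReal (Real.exp (x / 2 * g ^ 2))) g =
        ENNReal.ofReal ((√(2 * Real.pi))⁻¹ * Real.exp (-((1 - x) / 2) * g ^ 2)) := fun g => by
    rw [Pi.mul_apply, gaussianPDF, ← ENNReal.ofReal_mul (gaussianPDFReal_nonneg 0 1 g),
      gaussianPDFReal]
    simp only [NNReal.coe_one, mul_one, sub_zero, mul_assoc, ← Real.exp_add]
    congr 3
    ring
  rw [gaussianReal_of_var_ne_zero _ one_ne_zero,
    lintegral_withDensity_eq_lintegral_mul _ (measurable_gaussianPDF 0 1) (by fun_prop),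
    lintegral_congr hdensity, ← ofReal_integral_eq_lintegral_ofReal
      ((integrable_exp_neg_mul_sq (half_pos hx')).const_mul _)
      (ae_of_all _ fun g => by positivity),
    integral_const_mul, integral_gaussian, ← Real.sqrt_inv, ← Real.sqrt_mul (by positivity),
    ← Real.sqrt_inv]
  congr 2
  field_simp

lemma inv_sqrt_one_sub_le {x : ℝ} (hx0 : 0 ≤ x) (hx : x ≤ 3 / 4) : (√(1 - x))⁻¹ ≤ 1 + 2 * x := by
  rw [← Real.sqrt_inv]
  refine Real.sqrt_le_iff.2 ⟨by linarith, ?_⟩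
  rw [inv_le_iff_one_le_mul₀ (by linarith)]
  nlinarith [mul_nonneg hx0 (sub_nonneg.2 hx), mul_nonneg hx0 hx0,
    mul_nonneg (mul_nonneg hx0 hx0) (sub_nonneg.2 hx)]

lemma exp_neg_le_one_sub_add_sq_div_two {z : ℝ} (hz : 0 ≤ z) :
    Real.exp (-z) ≤ 1 - z + z ^ 2 / 2 := by
  have hexp := Real.quadratic_le_exp_of_nonneg hz
  have hpos : 0 ≤ 1 - z + z ^ 2 / 2 := by nlinarith [sq_nonneg (z - 1)]
  rw [Real.exp_neg, inv_le_iff_one_le_mul₀ (Real.exp_pos z)]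
  nlinarith [mul_le_mul_of_nonneg_left hexp hpos, sq_nonneg (z ^ 2)]

variable {Ω : Type*} [MeasurableSpace Ω] {μ : Measure Ω} [IsProbabilityMeasure μ] {Y : Ω → ℝ}
  {v : ℝ≥0}

lemma integral_eq_zero_of_hasSubgaussianMGF (hY : HasSubgaussianMGF Y v μ) :
    ∫ ω, Y ω ∂μ = 0 := by
  have hjensen (t : ℝ) : t * ∫ ω, Y ω ∂μ ≤ v * t ^ 2 / 2 := by
    have hle : Real.exp (∫ ω, t * Y ω ∂μ) ≤ ∫ ω, Real.exp (t * Y ω) ∂μ :=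
      convexOn_exp.map_integral_le Real.continuous_exp.continuousOn isClosed_univ
        (ae_of_all _ fun _ => Set.mem_univ _) (hY.integrable.const_mul t) (hY.integrable_exp_mul t)
    rw [← integral_const_mul]
    exact Real.exp_le_exp.1 (hle.trans (hY.mgf_le t))
  have hdiscrim := discrim_le_zero (a := (v / 2 : ℝ)) (b := -∫ ω, Y ω ∂μ) (c := 0) fun t => by
    linarith [hjensen t, show (v / 2 : ℝ) * (t * t) = v * t ^ 2 / 2 by ring]
  rw [discrim, mul_zero, sub_zero, neg_sq] at hdiscrim
  exact pow_eq_zero_iff two_ne_zero |>.1 (hdiscrim.antisymm (sq_nonneg _))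

-- Linearize the square: `exp (s Y²)` is the mean of `exp (√(2s) Y g)` over a standard Gaussian `g`.
lemma lintegral_exp_mul_sq_le (hY : HasSubgaussianMGF Y v μ) {s : ℝ} (hs : 0 ≤ s)
    (hsv : 2 * s * v < 1) :
    ∫⁻ ω, ENNReal.ofReal (Real.exp (s * Y ω ^ 2)) ∂μ ≤ ENNReal.ofReal (√(1 - 2 * s * v))⁻¹ := by
  have hsq : √(2 * s) ^ 2 = 2 * s := Real.sq_sqrt (by positivity)
  have hmeas : AEMeasurable Y μ := hY.aestronglyMeasurable.aemeasurable
  have hlinearize (ω : Ω) : ENNReal.ofReal (Real.exp (s * Y ω ^ 2)) =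
      ∫⁻ g, ENNReal.ofReal (Real.exp (√(2 * s) * Y ω * g)) ∂(gaussianReal 0 1) := by
    have hmgf := mgf_gaussianReal (p := gaussianReal 0 1) Measure.map_id (√(2 * s) * Y ω)
    simp only [mgf, id] at hmgf
    rw [← ofReal_integral_eq_lintegral_ofReal (integrable_exp_mul_gaussianReal _)
      (ae_of_all _ fun g => by positivity), hmgf, mul_pow, hsq, NNReal.coe_one]
    ring_nf
  calc ∫⁻ ω, ENNReal.ofReal (Real.exp (s * Y ω ^ 2)) ∂μ
      = ∫⁻ g, ∫⁻ ω, ENNReal.ofReal (Real.exp (√(2 * s) * Y ω * g)) ∂μ ∂(gaussianReal 0 1) := by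
        rw [lintegral_congr hlinearize, lintegral_lintegral_swap]
        exact ((Real.measurable_exp.comp_aemeasurable
          ((hmeas.comp_fst.const_mul _).mul measurable_snd.aemeasurable)).ennreal_ofReal)
    _ ≤ ∫⁻ g, ENNReal.ofReal (Real.exp (2 * s * v / 2 * g ^ 2)) ∂(gaussianReal 0 1) := by
        refine lintegral_mono fun g => ?_
        simp only [mul_right_comm _ (Y _) g]
        rw [← ofReal_integral_eq_lintegral_ofReal (hY.integrable_exp_mul _)
          (ae_of_all _ fun ω => by positivity)]
        refine ENNReal.ofReal_le_ofReal ((hY.mgf_le _).trans_eq ?_)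
        rw [mul_pow, hsq]
        ring_nf
    _ = ENNReal.ofReal (√(1 - 2 * s * v))⁻¹ := lintegral_exp_mul_sq_gaussianReal hsv

lemma integrable_exp_mul_sq (hY : HasSubgaussianMGF Y v μ) {s : ℝ} (hs : 0 ≤ s)
    (hsv : 2 * s * v < 1) : Integrable (fun ω => Real.exp (s * Y ω ^ 2)) μ := by
  have hmeas := hY.aestronglyMeasurable.aemeasurable
  refine ⟨(Real.measurable_exp.comp_aemeasurable
    ((hmeas.pow_const 2).const_mul s)).aestronglyMeasurable, ?_⟩
  rw [hasFiniteIntegral_iff_ofReal (ae_of_all _ fun ω => by positivity)]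
  exact (lintegral_exp_mul_sq_le hY hs hsv).trans_lt ENNReal.ofReal_lt_top

lemma mgf_sq_le (hY : HasSubgaussianMGF Y v μ) {s : ℝ} (hs : 0 ≤ s) (hsv : 2 * s * v ≤ 3 / 4) :
    mgf (fun ω => Y ω ^ 2) μ s ≤ 1 + 4 * s * v := by
  have hlt : 2 * s * v < 1 := by linarith
  rw [mgf, integral_eq_lintegral_of_nonneg_ae (ae_of_all _ fun ω => by positivity)
    (integrable_exp_mul_sq hY hs hlt).aestronglyMeasurable]
  refine (ENNReal.toReal_le_of_le_ofReal (by positivity)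
    (lintegral_exp_mul_sq_le hY hs hlt)).trans ?_
  exact (inv_sqrt_one_sub_le (by positivity) hsv).trans_eq (by ring)

lemma mgf_sq_neg_le (hY : HasSubgaussianMGF Y v μ) {r s : ℝ} (hr : 0 ≤ r) (hs : 0 < s)
    (hsv : 2 * s * v ≤ 3 / 4) :
    mgf (fun ω => Y ω ^ 2) μ (-r) ≤ 1 - r * ∫ ω, Y ω ^ 2 ∂μ + 4 * r ^ 2 / s * v := by
  have hpointwise (ω : Ω) : Real.exp (-r * Y ω ^ 2) ≤
      1 - r * Y ω ^ 2 + (r / s) ^ 2 * (Real.exp (s * Y ω ^ 2) - 1) := by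
    have hnonneg : 0 ≤ s * Y ω ^ 2 := by positivity
    have hneg := exp_neg_le_one_sub_add_sq_div_two (z := r * Y ω ^ 2) (by positivity)
    have hquad : (s * Y ω ^ 2) ^ 2 / 2 ≤ Real.exp (s * Y ω ^ 2) - 1 := by
      linarith [Real.quadratic_le_exp_of_nonneg hnonneg]
    have hscale : (r * Y ω ^ 2) ^ 2 / 2 = (r / s) ^ 2 * ((s * Y ω ^ 2) ^ 2 / 2) := by field_simp
    rw [neg_mul]
    linarith [mul_le_mul_of_nonneg_left hquad (sq_nonneg (r / s))]
  have hexp := integrable_exp_mul_sq hY hs.le (by linarith)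
  have hsq : Integrable (fun ω => Y ω ^ 2) μ := (hY.memLp 2).integrable_sq
  calc mgf (fun ω => Y ω ^ 2) μ (-r)
      ≤ ∫ ω, (1 - r * Y ω ^ 2 + (r / s) ^ 2 * (Real.exp (s * Y ω ^ 2) - 1)) ∂μ :=
        integral_mono_of_nonneg (ae_of_all _ fun ω => (Real.exp_pos _).le)
          (by fun_prop) (ae_of_all _ hpointwise)
    _ = 1 - r * ∫ ω, Y ω ^ 2 ∂μ + (r / s) ^ 2 * (mgf (fun ω => Y ω ^ 2) μ s - 1) := by
        rw [integral_add (by fun_prop) (by fun_prop), integral_sub (by fun_prop) (by fun_prop),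
          integral_const_mul, integral_const_mul, integral_sub hexp (by fun_prop)]
        simp [mgf]
    _ ≤ 1 - r * ∫ ω, Y ω ^ 2 ∂μ + (r / s) ^ 2 * (4 * s * v) := by
        gcongr
        linarith [mgf_sq_le hY hs.le hsv]
    _ = 1 - r * ∫ ω, Y ω ^ 2 ∂μ + 4 * r ^ 2 / s * v := by field_simp

end SubGaussianSquares

section Tails

variable {Ω κ : Type*} [MeasurableSpace Ω] {μ : Measure Ω} [Fintype κ] {W : κ → Ω → ℝ}
  {v : κ → ℝ≥0}

lemma mgf_sum_sq (hmeas : ∀ i, AEMeasurable (W i) μ) (hind : iIndepFun W μ) (t : ℝ) :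
    mgf (fun ω => ∑ i, W i ω ^ 2) μ t = ∏ i, mgf (fun ω => W i ω ^ 2) μ t := by
  have hsq : iIndepFun (fun i ω => W i ω ^ 2) μ :=
    hind.comp (fun _ x => x ^ 2) fun _ => by fun_prop
  rw [← hsq.mgf_sum₀ (fun i => (hmeas i).pow_const 2), Finset.sum_fn]

lemma mgf_sum_sq_le (hsub : ∀ i, HasSubgaussianMGF (W i) (v i) μ) (hind : iIndepFun W μ) {t : ℝ}
    {a : κ → ℝ} (ha : ∀ i, mgf (fun ω => W i ω ^ 2) μ t ≤ 1 + a i) :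
    mgf (fun ω => ∑ i, W i ω ^ 2) μ t ≤ Real.exp (∑ i, a i) := by
  rw [mgf_sum_sq (fun i => (hsub i).aestronglyMeasurable.aemeasurable) hind, Real.exp_sum]
  exact Finset.prod_le_prod (fun _ _ => mgf_nonneg) fun i _ =>
    (ha i).trans ((add_comm _ _).trans_le (Real.add_one_le_exp _))

variable [IsProbabilityMeasure μ]

lemma integrable_exp_mul_sum_sq (hsub : ∀ i, HasSubgaussianMGF (W i) (v i) μ)
    (hind : iIndepFun W μ) {s : ℝ} (hs : 0 ≤ s) (hsv : ∀ i, 2 * s * v i < 1) :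
    Integrable (fun ω => Real.exp (s * ∑ i, W i ω ^ 2)) μ := by
  have hpos : 0 < mgf (fun ω => ∑ i, W i ω ^ 2) μ s := by
    rw [mgf_sum_sq (fun i => (hsub i).aestronglyMeasurable.aemeasurable) hind]
    exact Finset.prod_pos fun i _ => mgf_pos (integrable_exp_mul_sq (hsub i) hs (hsv i))
  by_contra h
  exact hpos.ne' (mgf_undef h)

lemma measureReal_le_sum_sq_le (hsub : ∀ i, HasSubgaussianMGF (W i) (v i) μ)
    (hind : iIndepFun W μ) {s : ℝ} (hs : 0 ≤ s) (hsv : ∀ i, 2 * s * v i ≤ 3 / 4) (t : ℝ) :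
    μ.real {ω | t ≤ ∑ i, W i ω ^ 2} ≤ Real.exp (-s * t + 4 * s * ∑ i, (v i : ℝ)) := by
  refine (measure_ge_le_exp_mul_mgf t hs (integrable_exp_mul_sum_sq hsub hind hs
    fun i => (hsv i).trans_lt (by norm_num))).trans ?_
  rw [Real.exp_add, Finset.mul_sum]
  gcongr
  exact mgf_sum_sq_le hsub hind fun i => mgf_sq_le (hsub i) hs (hsv i)

lemma measureReal_sum_sq_le_le (hsub : ∀ i, HasSubgaussianMGF (W i) (v i) μ)
    (hind : iIndepFun W μ) {r s : ℝ} (hr : 0 ≤ r) (hs : 0 < s)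
    (hsv : ∀ i, 2 * s * v i ≤ 3 / 4) (t : ℝ) :
    μ.real {ω | ∑ i, W i ω ^ 2 ≤ t} ≤
      Real.exp (r * t + (-r * ∑ i, ∫ ω, W i ω ^ 2 ∂μ + 4 * r ^ 2 / s * ∑ i, (v i : ℝ))) := by
  have hmeas (i : κ) : AEMeasurable (W i) μ := (hsub i).aestronglyMeasurable.aemeasurable
  have hint : Integrable (fun ω => Real.exp (-r * ∑ i, W i ω ^ 2)) μ := by
    refine Integrable.of_bound (by fun_prop) 1 (ae_of_all _ fun ω => ?_)
    rw [Real.norm_eq_abs, Real.abs_exp, Real.exp_le_one_iff, neg_mul, neg_nonpos]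
    positivity
  refine (measure_le_le_exp_mul_mgf t (neg_nonpos.2 hr) hint).trans ?_
  rw [neg_neg, Real.exp_add, Finset.mul_sum, Finset.mul_sum, ← Finset.sum_add_distrib]
  gcongr
  refine mgf_sum_sq_le hsub hind fun i => (mgf_sq_neg_le (hsub i) hr hs (hsv i)).trans_eq ?_
  ring

end Tails

section RelSubGaussian

variable {Ω Ω' ι : Type*} [MeasurableSpace Ω] [MeasurableSpace Ω'] {μ : Measure Ω}
  {ν : Measure Ω'} {ρ : ℝ} {X : Ω → ℝ}

lemma isRelSubGaussian_iff : IsRelSubGaussian X ρ μ ↔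
    HasSubgaussianMGF X (ρ ^ 2 * ∫ ω, X ω ^ 2 ∂μ).toNNReal μ := by
  rw [IsRelSubGaussian, IsSubGaussian, mul_pow,
    Real.sq_sqrt (integral_nonneg fun ω => sq_nonneg (X ω))]

namespace IsRelSubGaussian

lemma hasSubgaussianMGF (hX : IsRelSubGaussian X ρ μ) :
    HasSubgaussianMGF X (ρ ^ 2 * ∫ ω, X ω ^ 2 ∂μ).toNNReal μ :=
  isRelSubGaussian_iff.1 hX

lemma aemeasurable (hX : IsRelSubGaussian X ρ μ) : AEMeasurable X μ :=
  hX.hasSubgaussianMGF.aestronglyMeasurable.aemeasurable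

lemma const_mul (hX : IsRelSubGaussian X ρ μ) (r : ℝ) :
    IsRelSubGaussian (fun ω => r * X ω) ρ μ := by
  rw [isRelSubGaussian_iff]
  convert hX.hasSubgaussianMGF.const_mul r using 1
  simp only [mul_pow, integral_const_mul]
  rw [mul_left_comm, Real.toNNReal_mul (sq_nonneg r), Real.toNNReal_of_nonneg (sq_nonneg r)]
  rfl

lemma comp_measurePreserving {Y : Ω' → ℝ} (hY : IsRelSubGaussian Y ρ ν) {f : Ω → Ω'}
    (hf : MeasurePreserving f μ ν) : IsRelSubGaussian (fun ω => Y (f ω)) ρ μ := by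
  have hY' : AEMeasurable Y (μ.map f) := by
    rw [hf.map_eq]
    exact hY.aemeasurable
  have hsq : ∫ ω, Y (f ω) ^ 2 ∂μ = ∫ ω, Y ω ^ 2 ∂ν := by
    rw [← hf.map_eq, integral_map hf.aemeasurable (hY'.pow_const 2).aestronglyMeasurable]
  rw [isRelSubGaussian_iff, hsq]
  refine HasSubgaussianMGF.of_map hf.aemeasurable ?_
  rw [hf.map_eq]
  exact hY.hasSubgaussianMGF

variable [IsProbabilityMeasure μ] [Fintype ι] {X : ι → Ω → ℝ}

lemma integral_sum_sq (hX : ∀ j, IsRelSubGaussian (X j) ρ μ) (hind : iIndepFun X μ) :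
    ∫ ω, (∑ j, X j ω) ^ 2 ∂μ = ∑ j, ∫ ω, X j ω ^ 2 ∂μ := by
  have hmean (j : ι) : ∫ ω, X j ω ∂μ = 0 :=
    integral_eq_zero_of_hasSubgaussianMGF (hX j).hasSubgaussianMGF
  have hmeanSum : ∫ ω, (∑ j, X j ω) ∂μ = 0 := by
    rw [integral_finsetSum _ fun j _ => (hX j).hasSubgaussianMGF.integrable]
    simp [hmean]
  have hvar : Var[fun ω => ∑ j, X j ω; μ] = ∑ j, Var[X j; μ] := by
    rw [← Finset.sum_fn]
    exact IndepFun.variance_sum (fun j _ => (hX j).hasSubgaussianMGF.memLp 2)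
      fun j _ k _ hjk => hind.indepFun hjk
  rw [variance_of_integral_eq_zero (by have := fun j => (hX j).aemeasurable; fun_prop) hmeanSum]
    at hvar
  simpa only [variance_of_integral_eq_zero (hX _).aemeasurable (hmean _)] using hvar

protected lemma sum (hX : ∀ j, IsRelSubGaussian (X j) ρ μ) (hind : iIndepFun X μ) :
    IsRelSubGaussian (fun ω => ∑ j, X j ω) ρ μ := by
  rw [isRelSubGaussian_iff, integral_sum_sq hX hind, Finset.mul_sum,
    Real.toNNReal_sum_of_nonneg fun j _ => by positivity]
  exact HasSubgaussianMGF.sum_of_iIndepFun hind fun j _ => (hX j).hasSubgaussianMGF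

end IsRelSubGaussian

end RelSubGaussian

section Concentration

/-- The exponential rate at which a sum of squares of independent variables with relative moment
`ρ` concentrates around its mean. -/
noncomputable def concentrationRate (ρ : ℝ) : ℝ :=
  min (3 / (256 * ρ ^ 4)) 1

lemma concentrationRate_pos {ρ : ℝ} (hρ : 0 < ρ) : 0 < concentrationRate ρ :=
  lt_min (by positivity) one_pos

variable {Ω κ : Type*} [MeasurableSpace Ω] {μ : Measure Ω} [IsProbabilityMeasure μ] [Fintype κ]
  {W : κ → Ω → ℝ} {ρ : ℝ}

lemma measureReal_mul_sum_le_sum_sq_le (hρ : 0 < ρ) (hW : ∀ i, IsRelSubGaussian (W i) ρ μ)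
    (hind : iIndepFun W μ) (hle : ∀ i, ∫ ω, W i ω ^ 2 ∂μ ≤ 1) :
    μ.real {ω | (3 * ρ) ^ 2 * ∑ i, ∫ ω', W i ω' ^ 2 ∂μ ≤ ∑ i, W i ω ^ 2} ≤
      Real.exp (-(concentrationRate ρ * ∑ i, ∫ ω, W i ω ^ 2 ∂μ)) := by
  have hv (i : κ) : ((ρ ^ 2 * ∫ ω, W i ω ^ 2 ∂μ).toNNReal : ℝ) = ρ ^ 2 * ∫ ω, W i ω ^ 2 ∂μ :=
    Real.coe_toNNReal _ (by positivity)
  set T := ∑ i, ∫ ω, W i ω ^ 2 ∂μ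
  have hT : 0 ≤ T := by positivity
  refine (measureReal_le_sum_sq_le (fun i => (hW i).hasSubgaussianMGF) hind
    (s := 3 / (8 * ρ ^ 2)) (by positivity) (fun i => ?_) _).trans (Real.exp_le_exp.2 ?_)
  · rw [hv]
    field_simp
    linarith [hle i]
  · simp only [hv, ← Finset.mul_sum]
    have hrate : concentrationRate ρ * T ≤ T := mul_le_of_le_one_left hT (min_le_right _ _)
    field_simp
    linarith

lemma measureReal_sum_sq_le_sum_div_four_le (hρ : 0 < ρ) (hW : ∀ i, IsRelSubGaussian (W i) ρ μ)
    (hind : iIndepFun W μ) (hle : ∀ i, ∫ ω, W i ω ^ 2 ∂μ ≤ 1) :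
    μ.real {ω | ∑ i, W i ω ^ 2 ≤ (∑ i, ∫ ω', W i ω' ^ 2 ∂μ) / 4} ≤
      Real.exp (-(concentrationRate ρ * ∑ i, ∫ ω, W i ω ^ 2 ∂μ)) := by
  have hv (i : κ) : ((ρ ^ 2 * ∫ ω, W i ω ^ 2 ∂μ).toNNReal : ℝ) = ρ ^ 2 * ∫ ω, W i ω ^ 2 ∂μ :=
    Real.coe_toNNReal _ (by positivity)
  set T := ∑ i, ∫ ω, W i ω ^ 2 ∂μ
  have : 0 ≤ T := by positivity
  refine (measureReal_sum_sq_le_le (fun i => (hW i).hasSubgaussianMGF) hind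
    (r := 3 / (64 * ρ ^ 4)) (s := 3 / (8 * ρ ^ 2)) (by positivity) (by positivity)
    (fun i => ?_) _).trans (Real.exp_le_exp.2 ?_)
  · rw [hv]
    field_simp
    linarith [hle i]
  · simp only [hv, ← Finset.mul_sum]
    have hrate : concentrationRate ρ * T ≤ 3 / (256 * ρ ^ 4) * T := by
      gcongr
      exact min_le_left _ _
    refine le_trans (le_of_eq ?_) (neg_le_neg hrate)
    field_simp
    ring

end Concentration

section RandomMatrix

variable {Ω ι κ : Type*} [MeasurableSpace Ω] {μ : Measure Ω}

lemma iIndepFun_curry {𝒳 : Type*} [MeasurableSpace 𝒳] {X : ι → κ → Ω → 𝒳}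
    (hX : ∀ i j, Measurable (X i j)) (hind : iIndepFun (fun (p : ι × κ) => X p.1 p.2) μ) :
    iIndepFun (fun i ω j => X i j ω) μ := by
  have := hind.isProbabilityMeasure
  have hprob (i : ι) (j : κ) : IsProbabilityMeasure (μ.map (X i j)) :=
    Measure.isProbabilityMeasure_map (hX i j).aemeasurable
  have hrow (i : ι) : iIndepFun (X i) μ :=
    hind.precomp (g := Prod.mk i) (Prod.mk_right_injective i)
  rw [iIndepFun_iff_map_fun_eq_infinitePi_map (by fun_prop)]
  simp only [(hrow _).map_fun_eq_infinitePi_map (hX _)]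
  rw [← Measure.infinitePi_map_curry, ← hind.map_fun_eq_infinitePi_map (by fun_prop),
    Measure.map_map (by fun_prop) (by fun_prop)]
  rfl

variable {Z : ι → Ω → EuclideanSpace ℝ κ} {ρ : ℝ} {c : κ → ℝ}

lemma iIndepFun_column_smul (hind : iIndepFun (fun (p : ι × κ) ω => Z p.1 ω p.2) μ)
    (u : ι → ℝ) (i : κ) : iIndepFun (fun j ω => u j * Z j ω i) μ :=
  (hind.precomp (Prod.mk_left_injective i)).comp (fun j x => u j * x) fun _ => by fun_prop

variable [Fintype ι] [Fintype κ]

lemma ofLp_synthesis (x : ι → EuclideanSpace ℝ κ) (u : EuclideanSpace ℝ ι) (i : κ) :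
    synthesis x u i = ∑ j, u j * x j i := by
  simp [synthesis_apply]

lemma iIndepFun_synthesis (hmeas : ∀ j, Measurable (Z j))
    (hind : iIndepFun (fun (p : ι × κ) ω => Z p.1 ω p.2) μ) (u : EuclideanSpace ℝ ι) :
    iIndepFun (fun i ω => synthesis (fun j => Z j ω) u i) μ := by
  simp only [ofLp_synthesis]
  exact (iIndepFun_curry (X := fun i j ω => Z j ω i) (by fun_prop)
    (hind.precomp Prod.swap_injective)).comp (fun _ z => ∑ j, u j * z j) fun _ => by fun_prop

variable [IsProbabilityMeasure μ]

lemma isRelSubGaussian_synthesis (hind : iIndepFun (fun (p : ι × κ) ω => Z p.1 ω p.2) μ)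
    (hsub : ∀ j i, IsRelSubGaussian (fun ω => Z j ω i) ρ μ) (u : EuclideanSpace ℝ ι) (i : κ) :
    IsRelSubGaussian (fun ω => synthesis (fun j => Z j ω) u i) ρ μ := by
  simp only [ofLp_synthesis]
  exact IsRelSubGaussian.sum (fun j => (hsub j i).const_mul _) (iIndepFun_column_smul hind u i)

lemma integral_sq_synthesis (hind : iIndepFun (fun (p : ι × κ) ω => Z p.1 ω p.2) μ)
    (hsub : ∀ j i, IsRelSubGaussian (fun ω => Z j ω i) ρ μ)
    (hsq : ∀ j i, ∫ ω, Z j ω i ^ 2 ∂μ = c i) (u : EuclideanSpace ℝ ι) (i : κ) :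
    ∫ ω, synthesis (fun j => Z j ω) u i ^ 2 ∂μ = ‖u‖ ^ 2 * c i := by
  simp only [ofLp_synthesis]
  rw [IsRelSubGaussian.integral_sum_sq (fun j => (hsub j i).const_mul _)
    (iIndepFun_column_smul hind u i)]
  simp only [mul_pow, integral_const_mul, hsq]
  rw [← Finset.sum_mul, EuclideanSpace.real_norm_sq_eq]

lemma measureReal_norm_synthesis_notMem_Icc_le (hρ : 0 < ρ) (hmeas : ∀ j, Measurable (Z j))
    (hind : iIndepFun (fun (p : ι × κ) ω => Z p.1 ω p.2) μ)
    (hsub : ∀ j i, IsRelSubGaussian (fun ω => Z j ω i) ρ μ)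
    (hsq : ∀ j i, ∫ ω, Z j ω i ^ 2 ∂μ = c i) (hc : ∀ i, c i ≤ 1) {u : EuclideanSpace ℝ ι}
    (hu : ‖u‖ = 1) :
    μ.real {ω | ‖synthesis (fun j => Z j ω) u‖ ∉ Set.Icc (√(∑ i, c i) / 2) (3 * ρ * √(∑ i, c i))} ≤
      2 * Real.exp (-(concentrationRate ρ * ∑ i, c i)) := by
  set W : κ → Ω → ℝ := fun i ω => synthesis (fun j => Z j ω) u i
  have hW (i : κ) : IsRelSubGaussian (W i) ρ μ := isRelSubGaussian_synthesis hind hsub u i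
  have hWind : iIndepFun W μ := iIndepFun_synthesis hmeas hind u
  have hWsq (i : κ) : ∫ ω, W i ω ^ 2 ∂μ = c i := by
    rw [integral_sq_synthesis hind hsub hsq, hu, one_pow, one_mul]
  have hWc (i : κ) : ∫ ω, W i ω ^ 2 ∂μ ≤ 1 := (hWsq i).trans_le (hc i)
  have hlower := measureReal_sum_sq_le_sum_div_four_le hρ hW hWind hWc
  have hupper := measureReal_mul_sum_le_sum_sq_le hρ hW hWind hWc
  simp only [hWsq] at hlower hupper
  rw [two_mul]
  refine (measureReal_mono (fun ω hω => ?_) (measure_ne_top _ _)).trans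
    ((measureReal_union_le _ _).trans (add_le_add hlower hupper))
  have hT : 0 ≤ ∑ i, c i := Finset.sum_nonneg fun i _ => (hWsq i).symm.trans_ge (by positivity)
  have hnorm : ∑ i, W i ω ^ 2 = ‖synthesis (fun j => Z j ω) u‖ ^ 2 :=
    (EuclideanSpace.real_norm_sq_eq _).symm
  have hsqrt : √(∑ i, c i) ^ 2 = ∑ i, c i := Real.sq_sqrt hT
  rw [Set.mem_ofPred_eq, Set.mem_Icc, not_and_or, not_le, not_le] at hω
  rw [Set.mem_union, Set.mem_ofPred_eq, Set.mem_ofPred_eq, hnorm, ← hsqrt, ← mul_pow,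
    show √(∑ i, c i) ^ 2 / 4 = (√(∑ i, c i) / 2) ^ 2 by ring]
  exact hω.imp (fun h => by gcongr) fun h => by gcongr

/-- The mesh at which a net of the unit sphere controls a matrix whose values on the net have norm
between `√T / 2` and `3 ρ √T`: it loses at most half of the lower bound. -/
noncomputable def netRadius (ρ : ℝ) : ℝ≥0 :=
  min (1 / 2) (1 / (24 * ρ)).toNNReal

lemma netRadius_pos (hρ : 0 < ρ) : 0 < netRadius ρ :=
  lt_min (by norm_num) (Real.toNNReal_pos.2 (by positivity))

lemma mul_netRadius_le (hρ : 0 < ρ) : 24 * ρ * netRadius ρ ≤ 1 := by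
  have hle : (netRadius ρ : ℝ) ≤ 1 / (24 * ρ) := by
    rw [← Real.coe_toNNReal (1 / (24 * ρ)) (by positivity)]
    exact_mod_cast min_le_right _ _
  calc 24 * ρ * netRadius ρ ≤ 24 * ρ * (1 / (24 * ρ)) := by gcongr
    _ = 1 := mul_one_div_cancel (by positivity)

lemma measureReal_exists_norm_synthesis_lt_le (hρ : 0 < ρ) (hmeas : ∀ j, Measurable (Z j))
    (hind : iIndepFun (fun (p : ι × κ) ω => Z p.1 ω p.2) μ)
    (hsub : ∀ j i, IsRelSubGaussian (fun ω => Z j ω i) ρ μ)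
    (hsq : ∀ j i, ∫ ω, Z j ω i ^ 2 ∂μ = c i) (hc : ∀ i, c i ≤ 1) :
    μ.real {ω | ∃ u, ‖u‖ = 1 ∧ ‖synthesis (fun j => Z j ω) u‖ < √(∑ i, c i) / 4} ≤
      (1 + 2 / netRadius ρ) ^ Fintype.card ι *
        (2 * Real.exp (-(concentrationRate ρ * ∑ i, c i))) := by
  obtain ⟨N, hNsub, hNcover, hNcard⟩ := exists_finset_isCover_of_subset_closedBall
    (netRadius_pos hρ) zero_le_one (Metric.sphere_subset_closedBall (x := (0 : EuclideanSpace ℝ ι)))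
  rw [finrank_euclideanSpace, mul_one] at hNcard
  set b := √(∑ i, c i)
  have hb : 0 ≤ b := Real.sqrt_nonneg _
  have hsub_union : {ω | ∃ u, ‖u‖ = 1 ∧ ‖synthesis (fun j => Z j ω) u‖ < b / 4} ⊆
      ⋃ u ∈ N, {ω | ‖synthesis (fun j => Z j ω) u‖ ∉ Set.Icc (b / 2) (3 * ρ * b)} := by
    rintro ω ⟨u, hu, hlt⟩
    by_contra hω
    simp only [Set.mem_iUnion, Set.mem_ofPred_eq, not_exists, not_not] at hω
    have hge := sub_le_norm_apply_of_isCover_sphere _ hNcover (min_le_left _ _)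
      (by positivity) (fun v hv => (hω v hv).1) (fun v hv => (hω v hv).2) hu
    nlinarith [mul_le_mul_of_nonneg_left (mul_netRadius_le hρ) hb]
  calc _ ≤ _ := measureReal_mono hsub_union (measure_ne_top _ _)
    _ ≤ ∑ u ∈ N, μ.real {ω | ‖synthesis (fun j => Z j ω) u‖ ∉ Set.Icc (b / 2) (3 * ρ * b)} :=
      measureReal_biUnion_finset_le _ _
    _ ≤ N.card * (2 * Real.exp (-(concentrationRate ρ * ∑ i, c i))) := by
      rw [← nsmul_eq_mul]
      exact Finset.sum_le_card_nsmul _ _ _ fun u hu =>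
        measureReal_norm_synthesis_notMem_Icc_le hρ hmeas hind hsub hsq hc
          (mem_sphere_zero_iff_norm.1 (hNsub hu))
    _ ≤ _ := by gcongr

end RandomMatrix

section Dimension

lemma norm_starProjection_span_image_sq {𝕜 E ι : Type*} [RCLike 𝕜] [NormedAddCommGroup E]
    [InnerProductSpace 𝕜 E] [FiniteDimensional 𝕜 E] [DecidableEq E] {a : ι → E}
    (ha : Orthonormal 𝕜 a) (I : Finset ι) (x : E) :
    ‖(Submodule.span 𝕜 (I.image a : Set E)).starProjection x‖ ^ 2 =
      ∑ i ∈ I, ‖inner 𝕜 (a i) x‖ ^ 2 := by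
  rw [Submodule.starProjection_apply, ← Submodule.coe_norm,
    ← (OrthonormalBasis.span ha I).sum_sq_norm_inner_right, ← I.sum_coe_sort]
  simp only [Submodule.inner_orthogonalProjectionOnto_eq_of_mem_left, OrthonormalBasis.span_apply]

lemma mul_le_sum_min {ι : Type*} [Fintype ι] {l : ι → ℝ} {b : ℝ} (hl : ∀ i, 0 ≤ l i) (hb : 0 ≤ b)
    {m : ℕ} (hm : m ≤ Fintype.card ι)
    (hI : ∀ I : Finset ι, I.card + m = Fintype.card ι → b * m ≤ ∑ i ∈ I, l i) :
    b * m ≤ ∑ i, min (l i) b := by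
  classical
  have hmin (i : ι) : 0 ≤ min (l i) b := le_min (hl i) hb
  set J : Finset ι := {i | b ≤ l i}
  rcases le_total m J.card with hJ | hJ
  · calc b * m ≤ ∑ _i ∈ J, b := by
          rw [Finset.sum_const, nsmul_eq_mul, mul_comm]
          gcongr
      _ = ∑ i ∈ J, min (l i) b :=
          Finset.sum_congr rfl fun i hi => (min_eq_right (Finset.mem_filter.1 hi).2).symm
      _ ≤ ∑ i, min (l i) b := Finset.sum_le_univ_sum_of_nonneg hmin
  · obtain ⟨K, hJK, -, hK⟩ := Finset.exists_subsuperset_card_eq J.subset_univ hJ hm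
    have hsmall (i : ι) (hi : i ∈ Kᶜ) : l i ≤ b := by
      by_contra! hlt
      exact Finset.mem_compl.1 hi (hJK (Finset.mem_filter.2 ⟨Finset.mem_univ i, hlt.le⟩))
    calc b * m ≤ ∑ i ∈ Kᶜ, l i := hI Kᶜ (by rw [Finset.card_compl, hK, Nat.sub_add_cancel hm])
      _ = ∑ i ∈ Kᶜ, min (l i) b :=
          Finset.sum_congr rfl fun i hi => (min_eq_left (hsmall i hi)).symm
      _ ≤ ∑ i, min (l i) b := Finset.sum_le_univ_sum_of_nonneg hmin

variable {d : ℕ} {P : Measure (EuclideanSpace ℝ (Fin d))} {γ : ℝ} {m : ℕ}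

lemma isLimited_of_sum_le {a : Fin d → EuclideanSpace ℝ (Fin d)} (ha : Orthonormal ℝ a)
    {I : Finset (Fin d)} {b : ℝ} (hI : I.card + m = d)
    (hint : ∀ i, Integrable (fun x => ⟪a i, x⟫ ^ 2) P)
    (hb : ∑ i ∈ I, ∫ x, ⟪a i, x⟫ ^ 2 ∂P ≤ b) : IsLimited P b m := by
  classical
  refine ⟨Submodule.span ℝ (I.image a : Set _), ?_, ?_⟩
  · rwa [Module.finrank_eq_card_basis (OrthonormalBasis.span ha I).toBasis, Fintype.card_coe]
  · simp only [norm_starProjection_span_image_sq ha, Real.norm_eq_abs, sq_abs]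
    rw [← ofReal_integral_eq_lintegral_ofReal (integrable_finsetSum _ fun i _ => hint i)
      (ae_of_all _ fun x => Finset.sum_nonneg fun i _ => sq_nonneg _),
      integral_finsetSum _ fun i _ => hint i]
    exact ENNReal.ofReal_le_ofReal hb

lemma marginAdaptedDim_le : marginAdaptedDim γ P ≤ d := by
  rcases (marginAdaptedDim γ P).eq_zero_or_pos with h0 | hpos
  · omega
  · obtain ⟨-, V, hV, -⟩ : marginAdaptedDim γ P ∈ {k : ℕ | 1 ≤ k ∧ IsLimited P (γ ^ 2 * k) k} :=
      Nat.sInf_mem (Nat.nonempty_of_pos_sInf hpos)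
    omega

lemma not_isLimited_of_lt_marginAdaptedDim (hm : m ≠ 0) (hlt : m < marginAdaptedDim γ P) :
    ¬ IsLimited P (γ ^ 2 * m) m :=
  fun h => Nat.notMem_of_lt_sInf hlt ⟨Nat.one_le_iff_ne_zero.2 hm, h⟩

lemma marginAdaptedDim_sub_one_le_sum {a : Fin d → EuclideanSpace ℝ (Fin d)} (ha : Orthonormal ℝ a)
    (hint : ∀ i, Integrable (fun x => ⟪a i, x⟫ ^ 2) P) (hγ : 0 < γ) :
    (marginAdaptedDim γ P : ℝ) - 1 ≤ ∑ i, min ((∫ x, ⟪a i, x⟫ ^ 2 ∂P) / γ ^ 2) 1 := by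
  rcases Nat.lt_or_ge 1 (marginAdaptedDim γ P) with hk | hk
  swap
  · exact (sub_nonpos.2 (by exact_mod_cast hk)).trans
      (Finset.sum_nonneg fun i _ => le_min (by positivity) zero_le_one)
  obtain ⟨m, hm⟩ : ∃ m, marginAdaptedDim γ P = m + 1 := Nat.exists_eq_add_one.2 (by omega)
  have hmd : m ≤ d := by have := marginAdaptedDim_le (γ := γ) (P := P); omega
  have hsum := mul_le_sum_min (l := fun i => ∫ x, ⟪a i, x⟫ ^ 2 ∂P) (b := γ ^ 2)
    (fun i => by positivity) (by positivity) (by simpa using hmd) fun I hI => by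
      rw [Fintype.card_fin] at hI
      by_contra! hlt
      exact not_isLimited_of_lt_marginAdaptedDim (by omega) (by omega)
        (isLimited_of_sum_le ha hI hint hlt.le)
  rw [hm, Nat.cast_add_one, add_sub_cancel_right]
  calc (m : ℝ) ≤ (∑ i, min (∫ x, ⟪a i, x⟫ ^ 2 ∂P) (γ ^ 2)) / γ ^ 2 := by
        rwa [le_div_iff₀' (by positivity)]
    _ = ∑ i, min ((∫ x, ⟪a i, x⟫ ^ 2 ∂P) / γ ^ 2) 1 := by
        rw [Finset.sum_div]
        refine Finset.sum_congr rfl fun i _ => ?_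
        rw [← min_div_div_right (by positivity), div_self (by positivity)]

end Dimension

section Whitening

variable {E ι : Type*} [NormedAddCommGroup E] [InnerProductSpace ℝ E] [Fintype ι]

/-- The factor by which a coordinate of second moment `l` is rescaled: it normalizes the variance
`l` to one, unless this would stretch the coordinate by more than `γ⁻¹`. Coordinates of variance
zero are sent to zero, since `0⁻¹ = 0`. -/
noncomputable def whiteningWeight (γ l : ℝ) : ℝ := min γ⁻¹ (√l)⁻¹

lemma whiteningWeight_nonneg {γ : ℝ} (hγ : 0 < γ) (l : ℝ) : 0 ≤ whiteningWeight γ l :=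
  le_min (by positivity) (by positivity)

lemma whiteningWeight_sq_mul {γ l : ℝ} (hγ : 0 < γ) (hl : 0 ≤ l) :
    whiteningWeight γ l ^ 2 * l = min (l / γ ^ 2) 1 := by
  rcases hl.eq_or_lt with rfl | hl
  · simp
  have hsq : whiteningWeight γ l ^ 2 = min (γ⁻¹ ^ 2) l⁻¹ := by
    rw [whiteningWeight, pow_left_monotoneOn.map_min (show 0 ≤ γ⁻¹ by positivity)
      (show 0 ≤ (√l)⁻¹ by positivity), inv_pow (√l), Real.sq_sqrt hl.le]
  rw [hsq, min_mul_of_nonneg _ _ hl.le, inv_mul_cancel₀ hl.ne', inv_pow, inv_mul_eq_div]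

/-- The linear map which reads off the coordinates in the basis `a` and rescales each of them
according to its second moment under `P`. -/
noncomputable def truncatedWhitening [MeasurableSpace E] (a : OrthonormalBasis ι ℝ E) (γ : ℝ)
    (P : Measure E) : E →L[ℝ] EuclideanSpace ℝ ι :=
  (EuclideanSpace.equiv ι ℝ).symm.toContinuousLinearMap ∘L ContinuousLinearMap.pi fun i =>
    whiteningWeight γ (∫ x, ⟪a i, x⟫ ^ 2 ∂P) • innerSL ℝ (a i)

variable [MeasurableSpace E] {P : Measure E} {a : OrthonormalBasis ι ℝ E} {γ : ℝ}

lemma truncatedWhitening_apply (x : E) (i : ι) :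
    truncatedWhitening a γ P x i = whiteningWeight γ (∫ z, ⟪a i, z⟫ ^ 2 ∂P) * ⟪a i, x⟫ :=
  rfl

lemma mul_norm_truncatedWhitening_le (hγ : 0 < γ) (x : E) :
    γ * ‖truncatedWhitening a γ P x‖ ≤ ‖x‖ := by
  rw [← le_inv_mul_iff₀ hγ]
  refine le_of_sq_le_sq ?_ (by positivity)
  rw [EuclideanSpace.real_norm_sq_eq, mul_pow, ← a.sum_sq_norm_inner_right x, Finset.mul_sum]
  gcongr with i
  rw [truncatedWhitening_apply, mul_pow, Real.norm_eq_abs, sq_abs]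
  gcongr
  · exact whiteningWeight_nonneg hγ _
  · exact min_le_left _ _

lemma integral_truncatedWhitening_sq (hγ : 0 < γ) (i : ι) :
    ∫ x, truncatedWhitening a γ P x i ^ 2 ∂P = min ((∫ x, ⟪a i, x⟫ ^ 2 ∂P) / γ ^ 2) 1 := by
  simp only [truncatedWhitening_apply, mul_pow, integral_const_mul]
  exact whiteningWeight_sq_mul hγ (by positivity)

lemma iIndepFun_truncatedWhitening (hind : iIndepFun (fun i x => ⟪a i, x⟫) P) :
    iIndepFun (fun i x => truncatedWhitening a γ P x i) P :=
  hind.comp (fun i r => whiteningWeight γ (∫ x, ⟪a i, x⟫ ^ 2 ∂P) * r) fun _ => by fun_prop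

lemma isRelSubGaussian_truncatedWhitening {ρ : ℝ} {i : ι}
    (hsub : IsRelSubGaussian (fun x => ⟪a i, x⟫) ρ P) :
    IsRelSubGaussian (fun x => truncatedWhitening a γ P x i) ρ P :=
  hsub.const_mul _

end Whitening

section Sample

lemma iIndepFun_comp_measurePreserving {Ω Ω' κ 𝒳 : Type*} [MeasurableSpace Ω] [MeasurableSpace Ω']
    [MeasurableSpace 𝒳] {μ : Measure Ω} {ν : Measure Ω'} {X : κ → Ω' → 𝒳} {f : Ω → Ω'}
    (hX : ∀ i, Measurable (X i)) (hind : iIndepFun X ν) (hf : MeasurePreserving f μ ν) :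
    iIndepFun (fun i ω => X i (f ω)) μ := by
  rw [iIndepFun_iff_measure_inter_preimage_eq_mul] at hind ⊢
  intro s sets hs
  have hpre (i : κ) (hi : i ∈ s) : MeasurableSet (X i ⁻¹' sets i) := hX i (hs i hi)
  have hprod := hind s hs
  rw [← hf.measure_preimage (s.measurableSet_biInter hpre).nullMeasurableSet] at hprod
  rw [Finset.prod_congr rfl fun i hi =>
    (hf.measure_preimage (hpre i hi).nullMeasurableSet).symm] at hprod
  simpa only [Set.preimage_iInter, Set.preimage_preimage] using hprod

lemma iIndepFun_pi_array {ι κ 𝒳 : Type*} [Fintype ι] [MeasurableSpace 𝒳] {P : Measure 𝒳}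
    {f : κ → 𝒳 → ℝ} (hf : ∀ i, Measurable (f i)) (hind : iIndepFun f P) :
    iIndepFun (fun (p : ι × κ) (x : ι → 𝒳) => f p.2 (x p.1)) (Measure.pi fun _ => P) := by
  have := hind.isProbabilityMeasure
  exact iIndepFun_uncurry' (X := fun j i (x : ι → 𝒳) => f i (x j)) (by fun_prop)
    (iIndepFun_pi (X := fun _ x i => f i x) fun _ => (measurable_pi_lambda _ hf).aemeasurable)
    fun j => iIndepFun_comp_measurePreserving hf hind (measurePreserving_eval _ j)

variable {d : ℕ} {P : Measure (EuclideanSpace ℝ (Fin d))} {ρ γ : ℝ} {ι : Type*} [Fintype ι]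

lemma shatteredWithMargin_of_le_norm_synthesis {a : OrthonormalBasis (Fin d) ℝ
    (EuclideanSpace ℝ (Fin d))} {x : ι → EuclideanSpace ℝ (Fin d)} {m : ℝ} (hγ : 0 < γ)
    (hm : √(Fintype.card ι) < m)
    (hx : ∀ u, ‖u‖ = 1 → m ≤ ‖synthesis (fun j => truncatedWhitening a γ P (x j)) u‖) :
    ShatteredWithMargin (linearClass d) γ x := by
  have hm0 : 0 < m := (Real.sqrt_nonneg _).trans_lt hm
  refine shatteredWithMargin_linearClass (m := γ * m) (by positivity) (by gcongr) fun u hu => ?_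
  calc γ * m ≤ γ * ‖truncatedWhitening a γ P (synthesis x u)‖ := by
        rw [map_synthesis]
        gcongr
        exact hx u hu
    _ ≤ ‖synthesis x u‖ := mul_norm_truncatedWhitening_le hγ _

lemma measureReal_not_shatteredWithMargin_le_exp (hρ : 0 < ρ) (hP : InFamily ρ P) (hγ : 0 < γ)
    (hcard : 16 * (Fintype.card ι : ℝ) < marginAdaptedDim γ P - 1) :
    (Measure.pi fun _ : ι => P).real {x | ¬ ShatteredWithMargin (linearClass d) γ x} ≤
      (1 + 2 / netRadius ρ) ^ Fintype.card ι *
        (2 * Real.exp (-(concentrationRate ρ * (marginAdaptedDim γ P - 1)))) := by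
  obtain ⟨B, -, a, hind, hsub⟩ := hP
  have := hind.isProbabilityMeasure
  set c : Fin d → ℝ := fun i => min ((∫ x, ⟪a i, x⟫ ^ 2 ∂P) / γ ^ 2) 1
  have hdim : (marginAdaptedDim γ P : ℝ) - 1 ≤ ∑ i, c i :=
    marginAdaptedDim_sub_one_le_sum a.orthonormal
      (fun i => ((hsub i).2.hasSubgaussianMGF.memLp 2).integrable_sq) hγ
  have hsq (j : ι) (i : Fin d) :
      ∫ x, truncatedWhitening a γ P (x j) i ^ 2 ∂(Measure.pi fun _ : ι => P) = c i :=
    (integral_comp_eval (μ := fun _ : ι => P) (f := fun z => truncatedWhitening a γ P z i ^ 2)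
      (by fun_prop)).trans (integral_truncatedWhitening_sq hγ i)
  have hbad := measureReal_exists_norm_synthesis_lt_le (μ := Measure.pi fun _ : ι => P)
    (Z := fun j x => truncatedWhitening a γ P (x j)) hρ (fun j => by fun_prop)
    (iIndepFun_pi_array (by fun_prop) (iIndepFun_truncatedWhitening hind))
    (fun j i => (isRelSubGaussian_truncatedWhitening (hsub i).2).comp_measurePreserving
      (measurePreserving_eval _ j))
    hsq (fun i => min_le_right _ _)
  have hsqrt : √(Fintype.card ι : ℝ) < √(∑ i, c i) / 4 := by
    rw [lt_div_iff₀ (by norm_num), ← Real.sqrt_sq (show (0 : ℝ) ≤ 4 by norm_num),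
      ← Real.sqrt_mul (by positivity)]
    exact Real.sqrt_lt_sqrt (by positivity) (by linarith)
  have hrate := (concentrationRate_pos hρ).le
  refine (measureReal_mono (fun x hx => ?_) (measure_ne_top _ _)).trans (hbad.trans (by gcongr))
  by_contra! hall
  simp only [Set.mem_ofPred_eq, not_exists, not_and, not_lt] at hall
  exact hx (shatteredWithMargin_of_le_norm_synthesis hγ hsqrt hall)

end Sample

section ShatteringProbability

variable {d : ℕ} {P : Measure (EuclideanSpace ℝ (Fin d))} {ρ γ : ℝ} {ι : Type*} [Fintype ι]

/-- The fraction of the margin-adapted dimension up to which an i.i.d. sample is shattered with high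
probability: there the covering number of the sphere is dominated by the concentration. -/
noncomputable def shatteringRatio (ρ : ℝ) : ℝ :=
  min (1 / 17) (concentrationRate ρ / (2 * Real.log (1 + 2 / netRadius ρ)))

lemma log_one_add_two_div_netRadius_pos (hρ : 0 < ρ) : 0 < Real.log (1 + 2 / netRadius ρ) :=
  Real.log_pos (lt_add_of_pos_right _ (div_pos two_pos (netRadius_pos hρ)))

lemma shatteringRatio_pos (hρ : 0 < ρ) : 0 < shatteringRatio ρ :=
  lt_min (by norm_num) (div_pos (concentrationRate_pos hρ)
    (mul_pos two_pos (log_one_add_two_div_netRadius_pos hρ)))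

lemma pow_card_le_exp (hρ : 0 < ρ) {t : ℝ} (ht : 0 ≤ t)
    (hcard : Fintype.card ι ≤ shatteringRatio ρ * t) :
    (1 + 2 / netRadius ρ) ^ Fintype.card ι ≤ Real.exp (concentrationRate ρ / 2 * t) := by
  have hlog := log_one_add_two_div_netRadius_pos hρ
  rw [← Real.exp_log (x := (1 + 2 / netRadius ρ : ℝ)) (by positivity), ← Real.exp_nat_mul,
    Real.exp_le_exp]
  calc Fintype.card ι * Real.log (1 + 2 / netRadius ρ)
      ≤ concentrationRate ρ / (2 * Real.log (1 + 2 / netRadius ρ)) * t *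
          Real.log (1 + 2 / netRadius ρ) := by
        gcongr
        exact hcard.trans (by gcongr; exact min_le_right _ _)
    _ = concentrationRate ρ / 2 * t := by field_simp

lemma measureReal_not_shatteredWithMargin_le (hρ : 0 < ρ) (hP : InFamily ρ P) (hγ : 0 < γ)
    (hcard : Fintype.card ι ≤ shatteringRatio ρ * (marginAdaptedDim γ P - 1)) :
    (Measure.pi fun _ : ι => P).real {x | ¬ ShatteredWithMargin (linearClass d) γ x} ≤
      2 * Real.exp (-(concentrationRate ρ / 2 * (marginAdaptedDim γ P - 1))) := by
  have hrate := concentrationRate_pos hρ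
  set t : ℝ := marginAdaptedDim γ P - 1
  rcases le_or_gt t 0 with ht | ht
  · have : IsProbabilityMeasure P := let ⟨_, _, _, hind, _⟩ := hP; hind.isProbabilityMeasure
    have hexp : 1 ≤ Real.exp (-(concentrationRate ρ / 2 * t)) :=
      Real.one_le_exp (neg_nonneg.2 (mul_nonpos_of_nonneg_of_nonpos (by positivity) ht))
    exact measureReal_le_one.trans (by linarith)
  have hsmall : 16 * (Fintype.card ι : ℝ) < t := by
    have : (Fintype.card ι : ℝ) ≤ 1 / 17 * t :=
      hcard.trans (by gcongr; exact min_le_left _ _)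
    linarith
  calc (Measure.pi fun _ : ι => P).real {x | ¬ ShatteredWithMargin (linearClass d) γ x}
      ≤ (1 + 2 / netRadius ρ) ^ Fintype.card ι * (2 * Real.exp (-(concentrationRate ρ * t))) :=
        measureReal_not_shatteredWithMargin_le_exp hρ hP hγ hsmall
    _ ≤ Real.exp (concentrationRate ρ / 2 * t) * (2 * Real.exp (-(concentrationRate ρ * t))) := by
        gcongr
        exact pow_card_le_exp hρ ht.le hcard
    _ = 2 * Real.exp (-(concentrationRate ρ / 2 * t)) := by
        rw [mul_left_comm, ← Real.exp_add]
        ring_nf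

end ShatteringProbability

section EmpiricalMinimizers

variable {𝒳 : Type*} {H : Set (𝒳 → ℝ)} {γ : ℝ} {n : ℕ}

/-- `h` minimizes the empirical `γ`-margin error on the sample `S` over `H`, as the output of a
margin-error minimization algorithm has to. -/
def IsEmpiricalMinimizer (H : Set (𝒳 → ℝ)) (γ : ℝ) (S : Fin n → 𝒳 × Label) (h : 𝒳 → ℝ) : Prop :=
  h ∈ H ∧ ∀ g ∈ H, empMarginLoss γ h S ≤ empMarginLoss γ g S

lemma exists_isEmpiricalMinimizer (hH : H.Nonempty) (γ : ℝ) (S : Fin n → 𝒳 × Label) :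
    ∃ h, IsEmpiricalMinimizer H γ S h := by
  set errors : (𝒳 → ℝ) → ℕ := fun h => Finset.card {i | ((S i).2 : ℝ) * h (S i).1 ≤ γ}
  obtain ⟨h, hh, hmin⟩ := exists_minimalFor_of_wellFoundedLT (· ∈ H) errors hH
  refine ⟨h, hh, fun g hg => ?_⟩
  have hle : errors h ≤ errors g := (le_total _ _).elim id (hmin hg)
  unfold empMarginLoss
  gcongr

lemma isEmpiricalMinimizer_of_forall_lt {h : 𝒳 → ℝ} (hh : h ∈ H) {S : Fin n → 𝒳 × Label}
    (hS : ∀ i, γ < (S i).2 * h (S i).1) : IsEmpiricalMinimizer H γ S h := by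
  refine ⟨hh, fun g _ => ?_⟩
  have hzero : empMarginLoss γ h S = 0 := by
    rw [empMarginLoss, Finset.filter_false_of_mem fun i _ => not_le.2 (hS i), Finset.card_empty,
      Nat.cast_zero, zero_div]
  rw [hzero, empMarginLoss]
  positivity

lemma exists_isMEM_of_exists_isEmpiricalMinimizer (hH : H.Nonempty) (p : (𝒳 → ℝ) → Prop) :
    ∃ A : ℝ → LearningAlgorithm 𝒳, IsMEM H A ∧ ∀ (γ : ℝ) (n : ℕ) (S : Fin n → 𝒳 × Label),
      (∃ h, IsEmpiricalMinimizer H γ S h ∧ p h) → p (A γ n S) := by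
  have hex (γ : ℝ) (n : ℕ) (S : Fin n → 𝒳 × Label) : ∃ h, IsEmpiricalMinimizer H γ S h ∧
      ((∃ h', IsEmpiricalMinimizer H γ S h' ∧ p h') → p h) := by
    by_cases hp : ∃ h, IsEmpiricalMinimizer H γ S h ∧ p h
    · exact hp.imp fun h hh => ⟨hh.1, fun _ => hh.2⟩
    · exact (exists_isEmpiricalMinimizer hH γ S).imp fun h hh => ⟨hh, fun h' => absurd h' hp⟩
  choose A hA hpA using hex
  exact ⟨A, fun γ _ n _ S => hA γ n S, hpA⟩

end EmpiricalMinimizers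

section DoubleSample

lemma measurePreserving_pi_comp_of_injective {ι κ 𝒵 : Type*} [Fintype ι] [Fintype κ]
    [MeasurableSpace 𝒵] (D : Measure 𝒵) [IsProbabilityMeasure D] {f : κ → ι}
    (hf : Function.Injective f) :
    MeasurePreserving (fun (S : ι → 𝒵) j => S (f j)) (Measure.pi fun _ => D)
      (Measure.pi fun _ => D) := by
  refine ⟨by fun_prop, ?_⟩
  have hind : iIndepFun (fun j (S : ι → 𝒵) => S (f j)) (Measure.pi fun _ => D) :=
    (iIndepFun_pi (X := fun _ z => z) fun _ => aemeasurable_id).precomp hf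
  rw [hind.map_fun_eq_pi_map fun j => (measurable_pi_apply (f j)).aemeasurable]
  congr with j : 1
  exact (measurePreserving_eval (fun _ : ι => D) (f j)).map_eq

lemma measureReal_preimage_le {α β : Type*} [MeasurableSpace α] [MeasurableSpace β]
    {μ : Measure α} {ν : Measure β} [IsFiniteMeasure ν] {f : α → β}
    (hf : MeasurePreserving f μ ν) (E : Set β) : μ.real (f ⁻¹' E) ≤ ν.real E := by
  have hle := Measure.le_map_apply hf.aemeasurable E
  rw [hf.map_eq] at hle
  exact ENNReal.toReal_mono (measure_ne_top _ _) hle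

variable {𝒳 : Type*} [MeasurableSpace 𝒳]

lemma one_le_marginLoss_add_marginLoss_neg (D : Measure (𝒳 × Label)) [IsProbabilityMeasure D]
    (h : 𝒳 → ℝ) : 1 ≤ marginLoss 0 h D + marginLoss 0 (-h) D := by
  have hcover : (Set.univ : Set (𝒳 × Label)) ⊆
      {p | (p.2 : ℝ) * h p.1 ≤ 0} ∪ {p | (p.2 : ℝ) * (-h) p.1 ≤ 0} := fun p _ => by
    rw [Set.mem_union, Set.mem_ofPred_eq, Set.mem_ofPred_eq, Pi.neg_apply, mul_neg, neg_nonpos]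
    exact le_total _ _
  calc 1 = D.real Set.univ := probReal_univ.symm
    _ ≤ _ := measureReal_mono hcover
    _ ≤ marginLoss 0 h D + marginLoss 0 (-h) D := measureReal_union_le _ _

variable {D : Measure (𝒳 × Label)} {H : Set (𝒳 → ℝ)} {γ δ : ℝ} {n m : ℕ}

/-- The samples on which a margin-error minimization algorithm may return a classifier that is wrong
with probability at least one half. -/
def misleadingSamples (H : Set (𝒳 → ℝ)) (γ : ℝ) (D : Measure (𝒳 × Label)) (n : ℕ) :
    Set (Fin n → 𝒳 × Label) :=
  {S | ∃ h, IsEmpiricalMinimizer H γ S h ∧ 1 / 2 ≤ marginLoss 0 h D}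

variable [IsProbabilityMeasure D]

lemma mem_misleadingSamples_or_mem_of_shattered (hneg : ∀ h ∈ H, -h ∈ H)
    {S : Fin n ⊕ Fin m → 𝒳 × Label}
    (hS : ShatteredWithMargin H γ fun j => (S j).1) :
    (fun i => S (Sum.inl i)) ∈ misleadingSamples H γ D n ∨
      (fun i => S (Sum.inr i)) ∈ misleadingSamples H γ D m := by
  have habs (y : Label) : |(y : ℝ)| = 1 := by rcases y.2 with h | h <;> simp [h]
  obtain ⟨h, hh, hmargin⟩ := hS
    (Sum.elim (fun i => ((S (Sum.inl i)).2 : ℝ)) fun i => -((S (Sum.inr i)).2 : ℝ))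
    (by rintro (i | i) <;> simp [habs])
  by_cases hD : 1 / 2 ≤ marginLoss 0 h D
  · exact Or.inl ⟨h, isEmpiricalMinimizer_of_forall_lt hh fun i => hmargin (Sum.inl i), hD⟩
  · refine Or.inr ⟨-h, isEmpiricalMinimizer_of_forall_lt (hneg h hh) fun i => ?_, ?_⟩
    · simpa using hmargin (Sum.inr i)
    · linarith [one_le_marginLoss_add_marginLoss_neg D h]

lemma one_le_measureReal_not_shattered_add (hneg : ∀ h ∈ H, -h ∈ H) :
    1 ≤ (Measure.pi fun _ : Fin n ⊕ Fin n => D.map Prod.fst).real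
        {x | ¬ ShatteredWithMargin H γ x} +
      2 * (Measure.pi fun _ : Fin n => D).real (misleadingSamples H γ D n) := by
  set μ : Measure (Fin n ⊕ Fin n → 𝒳 × Label) := Measure.pi fun _ => D
  have : IsProbabilityMeasure (D.map Prod.fst) :=
    Measure.isProbabilityMeasure_map measurable_fst.aemeasurable
  have hfst : MeasurePreserving (fun S j => (S j).1) μ
      (Measure.pi fun _ : Fin n ⊕ Fin n => D.map Prod.fst) :=
    measurePreserving_pi _ _ fun _ => measurable_fst.measurePreserving D
  have hcover : (Set.univ : Set (Fin n ⊕ Fin n → 𝒳 × Label)) ⊆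
      (fun S j => (S j).1) ⁻¹' {x | ¬ ShatteredWithMargin H γ x} ∪
        ((fun S i => S (Sum.inl i)) ⁻¹' misleadingSamples H γ D n ∪
          (fun S i => S (Sum.inr i)) ⁻¹' misleadingSamples H γ D n) := fun S _ => by
    by_cases hS : ShatteredWithMargin H γ fun j => (S j).1
    · exact Or.inr (mem_misleadingSamples_or_mem_of_shattered hneg hS)
    · exact Or.inl hS
  calc 1 = μ.real Set.univ := probReal_univ.symm
    _ ≤ _ := measureReal_mono hcover
    _ ≤ _ := measureReal_union_le _ _
    _ ≤ _ := add_le_add_right (measureReal_union_le _ _) _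
    _ ≤ _ := add_le_add (measureReal_preimage_le hfst _) (add_le_add
      (measureReal_preimage_le (measurePreserving_pi_comp_of_injective D Sum.inl_injective) _)
      (measureReal_preimage_le (measurePreserving_pi_comp_of_injective D Sum.inr_injective) _))
    _ = _ := by rw [two_mul]

lemma le_highProbLoss {A : LearningAlgorithm 𝒳} {a : ℝ} (hδ : 0 ≤ δ)
    (ha : δ < (Measure.pi fun _ : Fin n => D).real {S | a ≤ marginLoss 0 (A n S) D}) :
    a ≤ highProbLoss A D n δ := by
  refine le_csInf ⟨2, zero_le_two, ?_⟩ fun ε hε => ?_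
  · have hempty : {S | 2 ≤ marginLoss 0 (A n S) D} = ∅ :=
      Set.eq_empty_of_forall_notMem fun S => not_le.2 (measureReal_le_one.trans_lt one_lt_two)
    rwa [hempty, measureReal_empty]
  · by_contra! hlt
    exact ha.not_ge ((measureReal_mono fun S hS => hlt.le.trans hS).trans hε.2)

lemma exists_isMEM_half_le_highProbLoss (hneg : ∀ h ∈ H, -h ∈ H) (hδ : 0 ≤ δ)
    (hsh : (Measure.pi fun _ : Fin n ⊕ Fin n => D.map Prod.fst).real
      {x | ¬ ShatteredWithMargin H γ x} < 1 - 2 * δ) :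
    ∃ A : ℝ → LearningAlgorithm 𝒳, IsMEM H A ∧ 1 / 2 ≤ highProbLoss (A γ) D n δ := by
  have hmis : δ < (Measure.pi fun _ : Fin n => D).real (misleadingSamples H γ D n) := by
    linarith [one_le_measureReal_not_shattered_add (n := n) (γ := γ) (D := D) hneg]
  obtain ⟨S, h, hmin, -⟩ : (misleadingSamples H γ D n).Nonempty :=
    nonempty_of_measureReal_ne_zero (hδ.trans_lt hmis).ne'
  obtain ⟨A, hA, hbad⟩ := exists_isMEM_of_exists_isEmpiricalMinimizer ⟨h, hmin.1⟩
    fun h => 1 / 2 ≤ marginLoss 0 h D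
  exact ⟨A, hA, le_highProbLoss hδ (hmis.trans_le (measureReal_mono fun S hS => hbad γ n S hS))⟩

end DoubleSample

section SampleComplexity

lemma le_sampleComplexity {𝒳 : Type*} [MeasurableSpace 𝒳] {H : Set (𝒳 → ℝ)} {ε γ δ x : ℝ}
    {D : Measure (𝒳 × Label)}
    (h : ∀ n : ℕ, 1 ≤ n → n < x → ∃ A : ℝ → LearningAlgorithm 𝒳, IsMEM H A ∧
      ε < highProbLoss (A γ) D n δ - bestMarginLoss H γ D) :
    (x : EReal) ≤ ((sampleComplexity H ε γ D δ : ENNReal) : EReal) := by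
  have hceil : (⌈x⌉₊ : ℕ∞) ≤ sampleComplexity H ε γ D δ := by
    refine le_iInf₂ fun n ⟨hn, hle⟩ => ?_
    rw [Nat.cast_le, Nat.ceil_le]
    by_contra! hlt
    obtain ⟨A, hA, hε⟩ := h n hn hlt
    exact hε.not_ge (hle A hA n le_rfl)
  calc (x : EReal) ≤ ((⌈x⌉₊ : ℝ) : EReal) := EReal.coe_le_coe_iff.2 (Nat.le_ceil x)
    _ = (((⌈x⌉₊ : ℕ∞) : ENNReal) : EReal) := by
      rw [ENat.toENNReal_coe, ← ENNReal.ofReal_natCast, EReal.coe_ennreal_ofReal,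
        max_eq_left (Nat.cast_nonneg _)]
    _ ≤ ((sampleComplexity H ε γ D δ : ENNReal) : EReal) := by
      exact_mod_cast ENat.toENNReal_mono hceil

variable {d : ℕ}

lemma neg_mem_linearClass {h : EuclideanSpace ℝ (Fin d) → ℝ} (hh : h ∈ linearClass d) :
    -h ∈ linearClass d := by
  obtain ⟨w, hw, rfl⟩ := hh
  exact ⟨-w, by rwa [norm_neg], funext fun x => (inner_neg_right x w).symm⟩

lemma two_mul_exp_neg_lt {s t : ℝ} (hs : 0 < s) (ht : Real.log (2 / s) < t) :
    2 * Real.exp (-t) < s := by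
  rw [Real.log_lt_iff_lt_exp (by positivity), div_lt_iff₀ hs] at ht
  rwa [Real.exp_neg, ← div_eq_mul_inv, div_lt_iff₀' (Real.exp_pos t)]

lemma exists_isMEM_linearClass_half_le_highProbLoss {ρ γ δ : ℝ} (hρ : 0 < ρ)
    {D : Measure (EuclideanSpace ℝ (Fin d) × Label)} [IsProbabilityMeasure D]
    (hD : InFamily ρ (D.map Prod.fst)) (hγ : 0 < γ) (hδ : 0 ≤ δ) (hδ' : δ < 1 / 2) {n : ℕ}
    (hn : n ≤ shatteringRatio ρ / 2 * (marginAdaptedDim γ (D.map Prod.fst) - 1))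
    (hdim : Real.log (2 / (1 - 2 * δ)) <
      concentrationRate ρ / 2 * (marginAdaptedDim γ (D.map Prod.fst) - 1)) :
    ∃ A : ℝ → LearningAlgorithm (EuclideanSpace ℝ (Fin d)), IsMEM (linearClass d) A ∧
      1 / 2 ≤ highProbLoss (A γ) D n δ := by
  refine exists_isMEM_half_le_highProbLoss (fun _ => neg_mem_linearClass) hδ
    ((measureReal_not_shatteredWithMargin_le hρ hD hγ ?_).trans_lt
      (two_mul_exp_neg_lt (by linarith) hdim))
  rw [Fintype.card_sum, Fintype.card_fin, Nat.cast_add]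
  linarith

end SampleComplexity

end MarginLearning

theorem mainTheorem3_general (ρ : ℝ) (hρ : 0 < ρ) :
    ∃ β : ℝ, 0 < β ∧ ∀ δ : ℝ, 0 ≤ δ → δ < 1 / 2 → ∃ C : ℝ, 0 ≤ C ∧
      ∀ (d : ℕ) (D : Measure (EuclideanSpace ℝ (Fin d) × MarginLearning.Label)),
        IsProbabilityMeasure D →
        MarginLearning.InFamily ρ (D.map Prod.fst) →
        ∀ γ : ℝ, 0 < γ →
        ∀ ε : ℝ, ε < 1 / 2 - MarginLearning.bestMarginLoss (MarginLearning.linearClass d) γ D →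
          ((β * (MarginLearning.marginAdaptedDim γ (D.map Prod.fst) : ℝ) - C : ℝ) : EReal) ≤
            (((MarginLearning.sampleComplexity (MarginLearning.linearClass d) ε γ D δ :
              ℕ∞) : ENNReal) : EReal) := by
  have hratio := MarginLearning.shatteringRatio_pos hρ
  have hrate := MarginLearning.concentrationRate_pos hρ
  set β := MarginLearning.shatteringRatio ρ / 2
  set κ := MarginLearning.concentrationRate ρ / 2
  refine ⟨β, by positivity, fun δ hδ hδ' => ?_⟩
  have hlog : 0 ≤ Real.log (2 / (1 - 2 * δ)) :=
    Real.log_nonneg ((one_le_div₀ (by linarith)).2 (by linarith))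
  refine ⟨β * (1 + Real.log (2 / (1 - 2 * δ)) / κ), by positivity, fun d D _ hD γ hγ ε hε => ?_⟩
  refine MarginLearning.le_sampleComplexity fun n _ hn => ?_
  rw [← mul_sub, ← sub_sub] at hn
  have hgap := sub_pos.1 (pos_of_mul_pos_right (n.cast_nonneg.trans_lt hn) (by positivity))
  have hcard := hn.le.trans
    (mul_le_mul_of_nonneg_left (sub_le_self _ (by positivity : 0 ≤ Real.log _ / κ)) (by positivity))
  obtain ⟨A, hA, hhalf⟩ := MarginLearning.exists_isMEM_linearClass_half_le_highProbLoss hρ hD hγ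
    hδ hδ' hcard ((div_lt_iff₀' (by positivity)).1 hgap)
  exact ⟨A, hA, by linarith⟩

theorem mainTheorem3 (ρ : ℝ) (hρ : 0 < ρ) :
    ∃ β C : ℝ, 0 < β ∧ 0 ≤ C ∧
      ∀ (d : ℕ) (D : Measure (EuclideanSpace ℝ (Fin d) × MarginLearning.Label)),
        IsProbabilityMeasure D →
        MarginLearning.InFamily ρ (D.map Prod.fst) →
        ∀ γ : ℝ, 0 < γ →
        ∀ ε : ℝ, ε < 1 / 2 - MarginLearning.bestMarginLoss (MarginLearning.linearClass d) γ D →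
          ((β * (MarginLearning.marginAdaptedDim γ (D.map Prod.fst) : ℝ) - C : ℝ) : EReal) ≤
            (((MarginLearning.sampleComplexity (MarginLearning.linearClass d) ε γ D (1 / 4) :
              ℕ∞) : ENNReal) : EReal) := by
  obtain ⟨β, hβ, h⟩ := mainTheorem3_general ρ hρ
  obtain ⟨C, hC, hbound⟩ := h (1 / 4) (by norm_num) (by norm_num)
  exact ⟨β, C, hβ, hC, hbound⟩
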